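/- Let $X$ and $Y$ be connected, locally compact Hausdorff spaces with base points $x_0$ and $y_0$, both well-pointed (the inclusion of the base point is a cofibration, i.e. has the homotopy extension property). Function spaces carry the compact-open topology. For a map $f\colon A\to B$ let $\mathrm{map}(A,B;f)$ be the space of unbased maps $A\to B$ that are freely homotopic to $f$, based at $f$. Let $\mathrm{map}(X,Y;0)$ be the one for the null map $0$ with constant value $y_0$, and let $\mathrm{aut}_1 Z=\mathrm{map}(Z,Z;\mathrm{id}_Z)$. For a based space $(Z,z_0)$ and $n\ge 1$, the Gottlieb group $G_n(Z)\subseteq\pi_n(Z,z_0)$ is the image of the homomorphism $\pi_n(\mathrm{aut}_1 Z,\mathrm{id}_Z)\to\pi_n(Z,z_0)$ induced by the evaluation map $g\mapsto g(z_0)$. The space $Z$ is a *$G$-space* if $G_n(Z)=\pi_n(Z,z_0)$ for every $n\ge 1$. The space $Z$ is a *$T$-space* if its free loop fibration $\mathrm{ev}\colon\mathrm{map}(S^1,Z)\to Z$, $\mathrm{ev}(\gamma)=\gamma(1)$, defined on the space of all free loops, is fibre-homotopically trivial, i.e. fibre homotopy equivalent over $Z$ to the projection $Z\times\Omega Z\to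 Z$, where $\Omega Z=\mathrm{ev}^{-1}(z_0)$. Then: 1. If $Y$ is a $T$-space, then $\mathrm{map}(X,Y;0)$ is a $T$-space. 2. Suppose that the reduced suspension $\Sigma X$ is based homotopy equivalent to a (finite, infinite or empty) wedge $\bigvee_i S^{d_i}$ of spheres of dimensions $d_i\ge 1$. If $Y$ is a $G$-space, then $\mathrm{map}(X,Y;0)$ is a $G$-space. -/

import Mathlib

open scoped unitInterval Topology

namespace FunctionSpace

universe u v w

/-! ### Components of function spaces -/

/-- `map(X, Z; f)`: the space of all (unbased) maps `X → Z` that are freely homotopic to `f`,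
with the topology induced by the compact-open topology on `C(X, Z)`. -/
abbrev MapComponent {X : Type u} {Z : Type v} [TopologicalSpace X] [TopologicalSpace Z]
    (f : C(X, Z)) : Type (max u v) :=
  {g : C(X, Z) // g.Homotopic f}

/-- `f` as a point of `map(X, Z; f)`. -/
def MapComponent.base {X : Type u} {Z : Type v} [TopologicalSpace X] [TopologicalSpace Z]
    (f : C(X, Z)) : MapComponent f :=
  ⟨f, ContinuousMap.Homotopic.refl f⟩

/-- For locally compact `X`, the maps freely homotopic to `f` are exactly the path component
of `f` in `C(X, Z)`. -/
theorem homotopic_iff_mem_pathComponent {X : Type u} {Z : Type v} [TopologicalSpace X]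
    [TopologicalSpace Z] [LocallyCompactSpace X] (f g : C(X, Z)) :
    g.Homotopic f ↔ g ∈ pathComponent f := by
  constructor
  · rintro ⟨H⟩
    refine Joined.symm ⟨⟨H.curry, ?_, ?_⟩⟩
    · ext x; simp
    · ext x; simp
  · intro h
    obtain ⟨γ⟩ := Joined.symm h
    refine ⟨⟨⟨fun p => γ p.1 p.2, ?_⟩, ?_, ?_⟩⟩
    · exact ContinuousEval.continuous_eval.comp
        ((γ.continuous.comp continuous_fst).prodMk continuous_snd)
    · intro x; simp
    · intro x; simp

/-- The null map `X → Y`, constant at the base point `y₀`. -/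
abbrev nullMap (X : Type u) {Y : Type v} [TopologicalSpace X] [TopologicalSpace Y] (y₀ : Y) :
    C(X, Y) :=
  ContinuousMap.const X y₀

/-- `map(X, Y; 0)`: the component of the null map, based at the null map
`MapComponent.base (nullMap X y₀)`. -/
abbrev NullComponent (X : Type u) {Y : Type v} [TopologicalSpace X] [TopologicalSpace Y]
    (y₀ : Y) : Type (max u v) :=
  MapComponent (nullMap X y₀)

/-! ### Well-pointed spaces -/

/-- `(X, x₀)` is well-pointed: the inclusion `{x₀} → X` is a cofibration, i.e. it has the homotopy
extension property with respect to every space. -/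
def WellPointed (X : Type u) [TopologicalSpace X] (x₀ : X) : Prop :=
  ∀ (Z : Type u) [TopologicalSpace Z] (f : C(X, Z)) (h : C(I, Z)), h 0 = f x₀ →
    ∃ H : C(I × X, Z), (∀ x, H (0, x) = f x) ∧ ∀ t, H (t, x₀) = h t

/-! ### Gottlieb groups and `G`-spaces -/

/-- Postcomposition of a based `N`-cube with a continuous map. -/
def genLoopMap {N : Type w} {A : Type u} {B : Type v} [TopologicalSpace A] [TopologicalSpace B]
    (φ : C(A, B)) (a : A) (p : GenLoop N A a) : GenLoop N B (φ a) :=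
  ⟨φ.comp p.1, fun y hy => congrArg φ (p.2 y hy)⟩

/-- The map `φ_# : π_N(A, a) → π_N(B, φ a)` induced by a continuous map `φ`. -/
def homotopyGroupMapFun (N : Type w) {A : Type u} {B : Type v}
    [TopologicalSpace A] [TopologicalSpace B] (φ : C(A, B)) (a : A) :
    HomotopyGroup N A a → HomotopyGroup N B (φ a) :=
  Quotient.map (genLoopMap φ a) fun p q (h : GenLoop.Homotopic p q) =>
    show GenLoop.Homotopic _ _ from ContinuousMap.HomotopicRel.comp_continuousMap h φ

/-- `φ_#` as a group homomorphism. -/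
noncomputable def homotopyGroupMap (N : Type w) [DecidableEq N] [Nonempty N] {A : Type u}
    {B : Type v} [TopologicalSpace A] [TopologicalSpace B] (φ : C(A, B)) (a : A) :
    HomotopyGroup N A a →* HomotopyGroup N B (φ a) :=
  MonoidHom.mk' (homotopyGroupMapFun N φ a) (by
    intro x y
    obtain ⟨p, rfl⟩ := Quotient.exists_rep x
    obtain ⟨q, rfl⟩ := Quotient.exists_rep y
    have i : N := Classical.arbitrary N
    have h1 := HomotopyGroup.mul_spec (i := i) (p := p) (q := q)
    have h2 := HomotopyGroup.mul_spec (i := i) (p := genLoopMap φ a p) (q := genLoopMap φ a q)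
    have h3 : genLoopMap φ a (GenLoop.transAt i q p)
        = GenLoop.transAt i (genLoopMap φ a q) (genLoopMap φ a p) := by
      ext t
      change φ (GenLoop.transAt i q p t) = GenLoop.transAt i _ _ t
      simp only [GenLoop.transAt, GenLoop.coe_copy]
      split_ifs <;> rfl
    refine (congrArg (homotopyGroupMapFun N φ a) h1).trans (Eq.trans ?_ h2.symm)
    exact congrArg (Quotient.mk _) h3)

/-- `aut₁ Z`: the space of self-maps of `Z` freely homotopic to the identity. -/
abbrev AutOne (Z : Type u) [TopologicalSpace Z] : Type u :=
  MapComponent (ContinuousMap.id Z)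

/-- The evaluation map `ω : aut₁ Z → Z`, `ω g = g z₀`. -/
def evalMap {Z : Type u} [TopologicalSpace Z] (z₀ : Z) : C(AutOne Z, Z) :=
  ⟨fun g => g.1 z₀, (ContinuousEvalConst.continuous_eval_const z₀).comp continuous_subtype_val⟩

/-- The Gottlieb group `G_{m+1}(Z)`: the image of
`ω_# : π_{m+1}(aut₁ Z, id) → π_{m+1}(Z, z₀)`. -/
noncomputable def gottliebGroup (m : ℕ) (Z : Type u) [TopologicalSpace Z] (z₀ : Z) :
    Subgroup (HomotopyGroup.Pi (m + 1) Z z₀) :=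
  (homotopyGroupMap (Fin (m + 1)) (evalMap z₀)
    (MapComponent.base (ContinuousMap.id Z))).range

/-- `(Z, z₀)` is a `G`-space: `G_n(Z) = π_n(Z)` for all `n ≥ 1`. -/
def IsGSpace (Z : Type u) [TopologicalSpace Z] (z₀ : Z) : Prop :=
  ∀ m : ℕ, gottliebGroup m Z z₀ = ⊤

/-! ### `T`-spaces -/

/-- `p : E → B` and `p' : E' → B` are fibre homotopy equivalent over `B`. -/
def FibreHomotopyEquivalent {E : Type u} {E' : Type v} {B : Type w} [TopologicalSpace E]
    [TopologicalSpace E'] [TopologicalSpace B] (p : C(E, B)) (p' : C(E', B)) : Prop :=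
  ∃ (f : C(E, E')) (g : C(E', E)),
    (∀ e, p' (f e) = p e) ∧ (∀ e', p (g e') = p' e') ∧
    (∃ H : (g.comp f).Homotopy (ContinuousMap.id E), ∀ t e, p (H (t, e)) = p e) ∧
    (∃ H' : (f.comp g).Homotopy (ContinuousMap.id E'), ∀ t e', p' (H' (t, e')) = p' e')

/-- `p : E → B` is fibre-homotopically trivial: it is fibre homotopy equivalent to the product
projection `B × F → B`, with `F = p⁻¹(b₀)` the fibre over the base point. -/
def FibreHomotopicallyTrivial {E : Type u} {B : Type v} [TopologicalSpace E] [TopologicalSpace B]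
    (p : C(E, B)) (b₀ : B) : Prop :=
  FibreHomotopyEquivalent p (ContinuousMap.fst : C(B × {e : E // p e = b₀}, B))

/-- The free loop fibration `C(S¹, Z) → Z`, evaluation at `1 ∈ S¹`, on the space of all
free loops in `Z`. Its fibre over `z₀` is the based loop space `ΩZ`. -/
noncomputable def freeLoopEval (Z : Type u) [TopologicalSpace Z] : C(C(Circle, Z), Z) :=
  ⟨fun γ => γ 1, ContinuousEvalConst.continuous_eval_const 1⟩

/-- `(Z, z₀)` is a `T`-space: its free loop fibration is fibre-homotopically trivial. -/
def IsTSpace (Z : Type u) [TopologicalSpace Z] (z₀ : Z) : Prop :=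
  FibreHomotopicallyTrivial (freeLoopEval Z) z₀

/-! ### Reduced suspensions and wedges of spheres -/

/-- The quotient space `Z / S` obtained by collapsing `S` to a point. -/
abbrev Collapse {Z : Type u} [TopologicalSpace Z] (S : Set Z) : Type u :=
  Quot fun p q : Z => p ∈ S ∧ q ∈ S

/-- The reduced suspension `ΣX = X × I / (X × {0, 1} ∪ {x₀} × I)`. -/
abbrev ReducedSuspension (X : Type u) [TopologicalSpace X] (x₀ : X) : Type u :=
  Collapse {p : X × I | p.1 = x₀ ∨ p.2 = 0 ∨ p.2 = 1}

/-- The base point of `ΣX`. -/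
def ReducedSuspension.base {X : Type u} [TopologicalSpace X] (x₀ : X) : ReducedSuspension X x₀ :=
  Quot.mk _ (x₀, 0)

/-- The standard unit sphere `Sⁿ` in `ℝⁿ⁺¹`. -/
abbrev StdSphere (n : ℕ) : Type := Metric.sphere (0 : EuclideanSpace ℝ (Fin (n + 1))) 1

/-- The base point `(1, 0, …, 0)` of `Sⁿ`. -/
noncomputable def StdSphere.base (n : ℕ) : StdSphere n :=
  ⟨EuclideanSpace.single 0 1, by simp⟩

/-- The wedge `⋁ᵢ S^{dᵢ}`: the disjoint union of the spheres and an extra point, with all the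
base points and the extra point identified (so the empty wedge is a point). -/
abbrev WedgeOfSpheres {ι : Type u} (d : ι → ℕ) : Type u :=
  Collapse {p : PUnit.{u + 1} ⊕ (Σ i : ι, StdSphere (d i)) |
    p = Sum.inl PUnit.unit ∨ ∃ i, p = Sum.inr ⟨i, StdSphere.base (d i)⟩}

/-- The wedge point. -/
def WedgeOfSpheres.base {ι : Type u} (d : ι → ℕ) : WedgeOfSpheres d :=
  Quot.mk _ (Sum.inl PUnit.unit)

/-- Based homotopy equivalence of `(A, a)` and `(B, b)`. -/
def BasedHomotopyEquivalent {A : Type u} {B : Type v} [TopologicalSpace A] [TopologicalSpace B]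
    (a : A) (b : B) : Prop :=
  ∃ (f : C(A, B)) (g : C(B, A)), f a = b ∧ g b = a ∧
    (g.comp f).HomotopicRel (ContinuousMap.id A) {a} ∧
    (f.comp g).HomotopicRel (ContinuousMap.id B) {b}

/-- The based space `(Z, z₀)` splits as a (finite or infinite) wedge of spheres of positive
dimensions. -/
def SplitsAsWedgeOfSpheres (Z : Type u) [TopologicalSpace Z] (z₀ : Z) : Prop :=
  ∃ (ι : Type u) (d : ι → ℕ), (∀ i, 1 ≤ d i) ∧
    BasedHomotopyEquivalent z₀ (WedgeOfSpheres.base d)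

end FunctionSpace

/-! Write M for the component of the null map. Part 1: a free loop in M is a family over `X` of free
loops in `Y`, so a fibre homotopy trivialization for `Y` can be applied pointwise in `X`. Its maps
and homotopies lie over `Y`, hence control values at `1`. As the circle is path connected, the value
at `1` decides whether a loop in `C(X, Y)` stays in M.

Part 2: let a be in π_n(M), and let e be the map π_n(M) → π_n(Y) induced by evaluation at `x₀`.
Since `Y` is a `G`-space, e(a) comes from a loop of self-maps of `Y`. Composing these with the null
map gives a class b of constant maps with e(b) = e(a). It remains to treat b and the kernel element
ab⁻¹. By well-pointedness the latter is represented, up to homotopy, by a map X × Iⁿ → Y trivial on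
{x₀} × Iⁿ and X × ∂Iⁿ, that is, by a map from ΣⁿX. This is a suspension of a wedge of spheres, and
evaluation aut₁Y → Y is onto on homotopy groups, so the map lifts to aut₁Y (`liftsRel_prod_cube`). A
lift Θ acts on M by g ↦ (x ↦ Θ(x, s)(g x)), and its value at the null map is the given class
(`mk_mem_gottliebGroup`). For b, Θ is independent of x. -/

namespace FunctionSpace

open Topology

/-! ### Relative lifting up to homotopy, and its behaviour under collapses and wedges -/

section LiftsRel

variable {A B T T' : Type*} [TopologicalSpace A] [TopologicalSpace B] [TopologicalSpace T]
  [TopologicalSpace T']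

theorem homotopicRel_of_map {f g : C(T, B)} {S : Set T} (H : C(I × T, B))
    (h0 : ∀ x, H (0, x) = f x) (h1 : ∀ x, H (1, x) = g x) (hS : ∀ t, ∀ x ∈ S, H (t, x) = f x) :
    f.HomotopicRel g S :=
  ⟨⟨⟨H, h0, h1⟩, hS⟩⟩

theorem HomotopicRel.exists_map {f g : C(T, B)} {S : Set T} (h : f.HomotopicRel g S) :
    ∃ H : C(I × T, B), (∀ x, H (0, x) = f x) ∧ (∀ x, H (1, x) = g x) ∧
      ∀ t, ∀ x ∈ S, H (t, x) = f x := by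
  obtain ⟨H⟩ := h
  exact ⟨H.toContinuousMap, H.apply_zero, H.apply_one, fun t x hx => H.eq_fst t hx⟩

theorem HomotopicRel.precomp {f g : C(T, B)} {S : Set T} (h : f.HomotopicRel g S) (k : C(T', T))
    {S' : Set T'} (hk : ∀ x ∈ S', k x ∈ S) : (f.comp k).HomotopicRel (g.comp k) S' := by
  obtain ⟨H, h0, h1, hS⟩ := HomotopicRel.exists_map h
  exact homotopicRel_of_map (H.comp ((ContinuousMap.id I).prodMap k)) (fun x => h0 _)
    (fun x => h1 _) (fun t x hx => hS _ _ (hk x hx))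

/-- Maps of pairs `(T, S) → (B, φ a)` lift through `φ : (A, a) → (B, φ a)` up to homotopy
relative to `S`. -/
def LiftsRel (φ : C(A, B)) (a : A) (S : Set T) : Prop :=
  ∀ g : C(T, B), (∀ t ∈ S, g t = φ a) →
    ∃ G : C(T, A), (∀ t ∈ S, G t = a) ∧ (φ.comp G).HomotopicRel g S

variable {φ : C(A, B)} {a : A} {S : Set T} {S' : Set T'}

/-- The lifting property passes to pairs dominated up to relative homotopy. -/
theorem LiftsRel.of_dominated (h : LiftsRel φ a S) (f : C(T', T)) (k : C(T, T'))
    (hf : ∀ x ∈ S', f x ∈ S) (hk : ∀ x ∈ S, k x ∈ S')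
    (hkf : (k.comp f).HomotopicRel (ContinuousMap.id T') S') : LiftsRel φ a S' := by
  intro g hg
  obtain ⟨G, hG, hH⟩ := h (g.comp k) (fun t ht => hg _ (hk t ht))
  refine ⟨G.comp f, fun t ht => hG _ (hf t ht), ?_⟩
  have h1 := HomotopicRel.precomp hH f hf
  exact h1.trans (hkf.comp_continuousMap g)

theorem LiftsRel.of_homeomorph (h : LiftsRel φ a S) (e : T' ≃ₜ T)
    (he : ∀ x, e x ∈ S ↔ x ∈ S') : LiftsRel φ a S' := by
  refine h.of_dominated (e : C(T', T)) (e.symm : C(T, T')) (fun x hx => (he x).2 hx)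
    (fun x hx => (he _).1 (by simpa using hx)) ?_
  have : (e.symm : C(T, T')).comp (e : C(T', T)) = ContinuousMap.id T' := by
    ext x; simp
  rw [this]
  exact ContinuousMap.HomotopicRel.refl _

/-- `π : T' → T` is a quotient map which identifies `S` to the point `t₀` and is otherwise
injective. -/
structure IsCollapse (π : C(T', T)) (S : Set T') (t₀ : T) : Prop where
  isQuotientMap : IsQuotientMap π
  map_eq : ∀ x ∈ S, π x = t₀
  eq_or : ∀ x y, π x = π y → x = y ∨ (x ∈ S ∧ y ∈ S)
  nonempty : S.Nonempty

theorem IsCollapse.exists_desc {π : C(T', T)} {t₀ : T} (h : IsCollapse π S' t₀) {E : Type*}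
    [TopologicalSpace E] (g : C(T', E)) {e : E} (hg : ∀ x ∈ S', g x = e) :
    ∃ G : C(T, E), (∀ x, G (π x) = g x) ∧ G t₀ = e := by
  have hfac : ∀ x y, π x = π y → g x = g y := fun x y hxy => by
    rcases h.eq_or x y hxy with rfl | ⟨hx, hy⟩
    · rfl
    · rw [hg x hx, hg y hy]
  have hG : ∀ x, h.isQuotientMap.lift g hfac (π x) = g x := fun x =>
    DFunLike.congr_fun (h.isQuotientMap.lift_comp g hfac) x
  refine ⟨h.isQuotientMap.lift g hfac, hG, ?_⟩
  obtain ⟨x, hx⟩ := h.nonempty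
  exact (congrArg _ (h.map_eq x hx).symm).trans ((hG x).trans (hg x hx))

/-- The homotopy is curried to a map into `C(I, B)`, which descends along π itself; this avoids
showing that I × π is a quotient map. -/
theorem IsCollapse.homotopicRel_desc {π : C(T', T)} {t₀ : T} (h : IsCollapse π S' t₀)
    {f g : C(T, B)} (hfg : (f.comp π).HomotopicRel (g.comp π) S') : f.HomotopicRel g {t₀} := by
  obtain ⟨H, h0, h1, hS⟩ := HomotopicRel.exists_map hfg
  let K : C(T', C(I, B)) := ContinuousMap.curry (H.comp ContinuousMap.prodSwap)
  obtain ⟨G, hG, hGt⟩ := h.exists_desc K (e := ContinuousMap.const I (f t₀)) (fun x hx => by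
    ext t
    change H (t, x) = _
    rw [hS t x hx, ContinuousMap.comp_apply, h.map_eq x hx]; rfl)
  have hs := h.isQuotientMap.surjective
  refine homotopicRel_of_map (G.uncurry.comp ContinuousMap.prodSwap) (fun x => ?_) (fun x => ?_)
    (fun t x hx => ?_)
  · obtain ⟨x, rfl⟩ := hs x
    exact (DFunLike.congr_fun (hG x) 0).trans (h0 x)
  · obtain ⟨x, rfl⟩ := hs x
    exact (DFunLike.congr_fun (hG x) 1).trans (h1 x)
  · obtain rfl : x = t₀ := hx
    exact DFunLike.congr_fun hGt t

/-- Maps and relative homotopies constant on the collapsed set correspond to based ones on the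
quotient. -/
theorem IsCollapse.liftsRel_iff {π : C(T', T)} {t₀ : T} (h : IsCollapse π S' t₀) :
    LiftsRel φ a {t₀} ↔ LiftsRel φ a S' := by
  constructor
  · intro hl g hg
    obtain ⟨g', hg', hgt⟩ := h.exists_desc g hg
    obtain ⟨G, hG, hH⟩ := hl g' (by rintro t rfl; exact hgt)
    have hmem : ∀ x ∈ S', π x ∈ ({t₀} : Set T) := fun x hx => h.map_eq x hx
    refine ⟨G.comp π, fun t ht => hG _ (hmem t ht), ?_⟩
    have h1 := HomotopicRel.precomp hH π hmem
    have h2 : g'.comp π = g := by ext x; exact hg' x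
    rw [h2] at h1
    exact h1
  · intro hl g hg
    obtain ⟨G, hG, hH⟩ := hl (g.comp π) (fun t ht => by
      rw [ContinuousMap.comp_apply, h.map_eq t ht]; exact hg _ rfl)
    obtain ⟨G', hG', hGt⟩ := h.exists_desc G hG
    refine ⟨G', by rintro t rfl; exact hGt, h.homotopicRel_desc ?_⟩
    have h2 : G'.comp π = G := by ext x; exact hG' x
    rw [ContinuousMap.comp_assoc, h2]
    exact hH

theorem isCollapse_mk {Z : Type*} [TopologicalSpace Z] {S : Set Z} {z : Z} (hz : z ∈ S) :
    IsCollapse (⟨Quot.mk _, continuous_quot_mk⟩ : C(Z, Collapse S)) S (Quot.mk _ z) where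
  isQuotientMap := isQuotientMap_quot_mk
  map_eq x hx := Quot.sound ⟨hx, hz⟩
  eq_or x y hxy := by
    induction Quot.eqvGen_exact hxy with
    | rel x y h => exact Or.inr h
    | refl x => exact Or.inl rfl
    | symm x y h ih =>
      rcases ih (Quot.eqvGen_sound h) with rfl | ⟨h1, h2⟩
      · exact Or.inl rfl
      · exact Or.inr ⟨h2, h1⟩
    | trans x y z h h' ih ih' =>
      rcases ih (Quot.eqvGen_sound h) with rfl | ⟨h1, h2⟩
      · exact ih' (Quot.eqvGen_sound h')
      · rcases ih' (Quot.eqvGen_sound h') with rfl | ⟨h3, h4⟩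
        · exact Or.inr ⟨h1, h2⟩
        · exact Or.inr ⟨h1, h4⟩
  nonempty := ⟨z, hz⟩

/-- The lifting property for a wedge follows from that of its summands. -/
theorem liftsRel_punit_sum_sigma {ι : Type*} {K : ι → Type*} [∀ i, TopologicalSpace (K i)]
    (k : ∀ i, K i) (h : ∀ i, LiftsRel φ a ({k i} : Set (K i))) :
    LiftsRel φ a {p : PUnit ⊕ (Σ i, K i) |
      p = Sum.inl PUnit.unit ∨ ∃ i, p = Sum.inr ⟨i, k i⟩} := by
  intro g hg
  have hgi : ∀ i, g (Sum.inr ⟨i, k i⟩) = φ a := fun i => hg _ (Or.inr ⟨i, rfl⟩)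
  choose G hG hH using fun i => h i (g.comp ⟨fun x => Sum.inr ⟨i, x⟩, by fun_prop⟩)
    (by rintro t rfl; exact hgi i)
  choose H h0 h1 hS using fun i => HomotopicRel.exists_map (hH i)
  let F : C(PUnit ⊕ (Σ i, K i), A) :=
    ⟨Sum.elim (fun _ => a) (fun p => G p.1 p.2),
      continuous_const.sumElim (continuous_sigma fun i => (G i).continuous)⟩
  let L : C(PUnit ⊕ (Σ i, K i), C(I, B)) :=
    ⟨Sum.elim (fun _ => ContinuousMap.const I (φ a))
        (fun p => ((H p.1).comp ContinuousMap.prodSwap).curry p.2),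
      continuous_const.sumElim (continuous_sigma fun i =>
        (((H i).comp ContinuousMap.prodSwap).curry).continuous)⟩
  refine ⟨F, ?_, homotopicRel_of_map (L.uncurry.comp ContinuousMap.prodSwap) ?_ ?_ ?_⟩
  · rintro t (rfl | ⟨i, rfl⟩)
    · rfl
    · exact hG i _ rfl
  · rintro (x | ⟨i, x⟩)
    · rfl
    · exact h0 i x
  · rintro (x | ⟨i, x⟩)
    · exact (hg _ (Or.inl rfl)).symm
    · exact h1 i x
  · rintro t x (rfl | ⟨i, rfl⟩)
    · rfl
    · exact hS i t _ rfl

end LiftsRel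

/-! ### Families of generalized loops and the exponential law -/

section GenLoops

variable {A B T N : Type*} [TopologicalSpace A] [TopologicalSpace B] [TopologicalSpace T]

/-- A map on `T × I^N` which is constant on `T × ∂I^N`, as a family of generalized loops. -/
def genLoopCurry (F : C(T × (N → I), B)) (b : B) (hF : ∀ t, ∀ s ∈ Cube.boundary N, F (t, s) = b) :
    C(T, GenLoop N B b) :=
  ⟨fun t => ⟨F.curry t, fun s hs => hF t s hs⟩, F.curry.continuous.subtype_mk _⟩

/-- A family of generalized loops as a map on `T × I^N`. -/
def genLoopUncurry {b : B} (F : C(T, GenLoop N B b)) : C(T × (N → I), B) :=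
  ⟨fun p => F p.1 p.2, by fun_prop⟩

/-- Postcomposition of generalized loops as a continuous map. -/
def genLoopMapC (N : Type*) (φ : C(A, B)) (a : A) : C(GenLoop N A a, GenLoop N B (φ a)) :=
  genLoopCurry ⟨fun p : GenLoop N A a × (N → I) => φ (p.1 p.2), by fun_prop⟩ _
    (fun t s hs => congrArg φ (t.2 s hs))

/-- Exponential law for the lifting property. -/
theorem liftsRel_genLoopMapC_iff {φ : C(A, B)} {a : A} {S : Set T} :
    LiftsRel (genLoopMapC N φ a) GenLoop.const S ↔
      LiftsRel φ a {p : T × (N → I) | p.1 ∈ S ∨ p.2 ∈ Cube.boundary N} := by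
  constructor
  · intro h g hg
    obtain ⟨G, hG, hH⟩ := h (genLoopCurry g (φ a) (fun t s hs => hg _ (Or.inr hs)))
      (fun t ht => by ext s; exact hg (t, s) (Or.inl ht))
    obtain ⟨H, h0, h1, hS⟩ := HomotopicRel.exists_map hH
    refine ⟨genLoopUncurry G, ?_, homotopicRel_of_map
      ((genLoopUncurry H).comp (Homeomorph.prodAssoc I T (N → I)).symm) ?_ ?_ ?_⟩
    · rintro ⟨t, s⟩ (ht | hs)
      · exact DFunLike.congr_fun (hG t ht) s
      · exact (G t).2 s hs
    · rintro ⟨t, s⟩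
      exact DFunLike.congr_fun (h0 t) s
    · rintro ⟨t, s⟩
      exact DFunLike.congr_fun (h1 t) s
    · rintro r ⟨t, s⟩ (ht | hs)
      · exact DFunLike.congr_fun (hS r t ht) s
      · exact ((H (r, t)).2 s hs).trans (congrArg φ ((G t).2 s hs)).symm
  · intro h g hg
    obtain ⟨G, hG, hH⟩ := h (genLoopUncurry g) (by
      rintro ⟨t, s⟩ (ht | hs)
      · exact DFunLike.congr_fun (hg t ht) s
      · exact (g t).2 s hs)
    obtain ⟨H, h0, h1, hS⟩ := HomotopicRel.exists_map hH
    refine ⟨genLoopCurry G a (fun t s hs => hG _ (Or.inr hs)), fun t ht => ?_,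
      homotopicRel_of_map (genLoopCurry (H.comp (Homeomorph.prodAssoc I T (N → I))) (φ a) ?_)
        ?_ ?_ ?_⟩
    · ext s; exact hG _ (Or.inl ht)
    · rintro ⟨r, t⟩ s hs
      exact (hS r (t, s) (Or.inr hs)).trans (congrArg φ (hG _ (Or.inr hs)))
    · intro t; ext s; exact h0 (t, s)
    · intro t; ext s; exact h1 (t, s)
    · intro r t ht; ext s; exact hS r (t, s) (Or.inl ht)

end GenLoops

/-! ### The sphere as a cube with collapsed boundary -/

section CubeToSphere

variable {d : ℕ}

/-- The centred coordinates `2x - 1` of a point of the cube. -/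
def cubeCentred (x : Fin d → I) : Fin d → ℝ := fun i => 2 * (x i : ℝ) - 1

/-- The distance to the boundary of the cube, up to a factor. -/
noncomputable def cubeDepth (x : Fin d → I) : ℝ := 1 - ‖cubeCentred x‖

/-- The squared Euclidean norm of the centred coordinates. -/
def cubeSq (x : Fin d → I) : ℝ := ∑ i, cubeCentred x i ^ 2

theorem abs_cubeCentred_le (x : Fin d → I) (i : Fin d) : |cubeCentred x i| ≤ 1 := by
  have h0 := (x i).2.1
  have h1 := (x i).2.2
  rw [abs_le]
  constructor <;> simp only [cubeCentred] <;> linarith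

theorem cubeDepth_nonneg (x : Fin d → I) : 0 ≤ cubeDepth x := by
  have : ‖cubeCentred x‖ ≤ 1 := (pi_norm_le_iff_of_nonneg zero_le_one).2 (abs_cubeCentred_le x)
  simp only [cubeDepth]; linarith

theorem cubeSq_nonneg (x : Fin d → I) : 0 ≤ cubeSq x :=
  Finset.sum_nonneg fun _ _ => sq_nonneg _

/-- Makes the denominators of the inverse stereographic projection nonzero: at depth zero the
centred vector has sup norm one. -/
theorem cubeSq_add_pos (x : Fin d → I) : 0 < cubeSq x + cubeDepth x ^ 2 := by
  rcases (cubeDepth_nonneg x).eq_or_lt with hb | hb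
  · have hu : cubeCentred x ≠ 0 := by
      intro h0
      simp only [cubeDepth, h0, norm_zero] at hb
      norm_num at hb
    obtain ⟨i, hi⟩ := Function.ne_iff.1 hu
    have h1 : cubeCentred x i ^ 2 ≤ cubeSq x :=
      Finset.single_le_sum (f := fun i => cubeCentred x i ^ 2) (fun _ _ => sq_nonneg _)
        (Finset.mem_univ i)
    have h2 : 0 < cubeCentred x i ^ 2 := by
      have : cubeCentred x i ≠ 0 := hi
      positivity
    nlinarith [sq_nonneg (cubeDepth x)]
  · have := cubeSq_nonneg x
    positivity

theorem continuous_cubeCentred : Continuous (cubeCentred (d := d)) := by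
  unfold cubeCentred; fun_prop

theorem cubeDepth_eq_zero_iff (x : Fin d → I) :
    cubeDepth x = 0 ↔ x ∈ Cube.boundary (Fin d) := by
  have hle : ‖cubeCentred x‖ ≤ 1 := by have := cubeDepth_nonneg x; simp only [cubeDepth] at this; linarith
  constructor
  · intro h
    by_contra hx
    have hlt : ‖cubeCentred x‖ < 1 := by
      rw [pi_norm_lt_iff one_pos]
      intro i
      have h0 : x i ≠ 0 := fun h0 => hx ⟨i, Or.inl h0⟩
      have h1 : x i ≠ 1 := fun h1 => hx ⟨i, Or.inr h1⟩
      have h0' : (0 : ℝ) < x i := unitInterval.pos_iff_ne_zero.2 h0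
      have h1' : (x i : ℝ) < 1 := unitInterval.lt_one_iff_ne_one.2 h1
      rw [Real.norm_eq_abs, abs_lt]
      constructor <;> simp only [cubeCentred] <;> linarith
    simp only [cubeDepth] at h
    linarith
  · rintro ⟨i, hi⟩
    have h1 : |cubeCentred x i| = 1 := by
      rcases hi with hi | hi <;> simp only [cubeCentred, hi] <;> norm_num
    have h2 : |cubeCentred x i| ≤ ‖cubeCentred x‖ := norm_le_pi_norm (cubeCentred x) i
    simp only [cubeDepth]
    linarith

/-- The vector underlying the collapse of the cube onto the sphere: inverse stereographic
projection of `u / b`, with `u` the centred coordinates and `b` the depth. -/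
noncomputable def cubeToSphereVec (x : Fin d → I) : EuclideanSpace ℝ (Fin (d + 1)) :=
  WithLp.toLp 2 (Fin.cons ((cubeSq x - cubeDepth x ^ 2) / (cubeSq x + cubeDepth x ^ 2))
    fun i => 2 * cubeDepth x * cubeCentred x i / (cubeSq x + cubeDepth x ^ 2))

theorem cubeToSphereVec_zero (x : Fin d → I) : cubeToSphereVec x 0 =
    (cubeSq x - cubeDepth x ^ 2) / (cubeSq x + cubeDepth x ^ 2) := rfl

theorem cubeToSphereVec_succ (x : Fin d → I) (i : Fin d) : cubeToSphereVec x i.succ =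
    2 * cubeDepth x * cubeCentred x i / (cubeSq x + cubeDepth x ^ 2) := rfl

theorem mem_stdSphere_iff (v : EuclideanSpace ℝ (Fin (d + 1))) :
    v ∈ Metric.sphere (0 : EuclideanSpace ℝ (Fin (d + 1))) 1 ↔
      v 0 ^ 2 + ∑ i : Fin d, v i.succ ^ 2 = 1 := by
  rw [mem_sphere_zero_iff_norm, EuclideanSpace.norm_eq, Real.sqrt_eq_one, Fin.sum_univ_succ]
  simp only [Real.norm_eq_abs, sq_abs]

theorem cubeToSphereVec_mem (x : Fin d → I) :
    cubeToSphereVec x ∈ Metric.sphere (0 : EuclideanSpace ℝ (Fin (d + 1))) 1 := by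
  have hD := (cubeSq_add_pos x).ne'
  rw [mem_stdSphere_iff, cubeToSphereVec_zero]
  simp only [cubeToSphereVec_succ, div_pow, mul_pow]
  rw [← Finset.sum_div, ← Finset.mul_sum]
  change _ + 2 ^ 2 * cubeDepth x ^ 2 * cubeSq x / _ = 1
  field_simp
  ring

theorem continuous_cubeToSphereVec : Continuous (cubeToSphereVec (d := d)) := by
  have h1 : Continuous (cubeDepth (d := d)) := continuous_const.sub continuous_cubeCentred.norm
  have h3 : ∀ i, Continuous fun x : Fin d → I => cubeCentred x i := fun i =>
    (continuous_apply i).comp continuous_cubeCentred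
  have h2 : Continuous (cubeSq (d := d)) := continuous_finsetSum _ fun i _ => (h3 i).pow 2
  refine (PiLp.continuous_toLp 2 _).comp (continuous_pi fun i => ?_)
  refine Fin.cases ?_ (fun i => ?_) i
  · exact (h2.sub (h1.pow 2)).div (h2.add (h1.pow 2)) fun x => (cubeSq_add_pos x).ne'
  · exact ((continuous_const.mul h1).mul (h3 i)).div (h2.add (h1.pow 2))
      fun x => (cubeSq_add_pos x).ne'

/-- The map `I^d → S^d` collapsing the boundary of the cube to the base point. -/
noncomputable def cubeToSphere (d : ℕ) : C(Fin d → I, StdSphere d) :=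
  ⟨fun x => ⟨cubeToSphereVec x, cubeToSphereVec_mem x⟩, continuous_cubeToSphereVec.subtype_mk _⟩

theorem cubeToSphere_of_mem_boundary {x : Fin d → I}
    (hx : x ∈ Cube.boundary (Fin d)) : cubeToSphere d x = StdSphere.base d := by
  have hb := (cubeDepth_eq_zero_iff x).2 hx
  have hD := cubeSq_add_pos x
  apply Subtype.ext
  ext i
  change cubeToSphereVec x i = EuclideanSpace.single (0 : Fin (d + 1)) (1 : ℝ) i
  rw [hb] at hD
  refine Fin.cases ?_ (fun i => ?_) i
  · rw [cubeToSphereVec_zero, hb]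
    simp only [ne_eq, OfNat.ofNat_ne_zero, not_false_eq_true, zero_pow, sub_zero, add_zero] at hD ⊢
    simp [hD.ne']
  · rw [cubeToSphereVec_succ, hb]
    simp

theorem cubeToSphere_surjective (hd : 1 ≤ d) : Function.Surjective (cubeToSphere d) := by
  rintro ⟨v, hv⟩
  rw [mem_stdSphere_iff] at hv
  by_cases hc : v 0 = 1
  -- The pole is hit by a corner of the cube, which is a boundary point because `1 ≤ d`.
  · refine ⟨fun _ => 0, ?_⟩
    rw [cubeToSphere_of_mem_boundary ⟨⟨0, hd⟩, Or.inl rfl⟩]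
    have h0 : ∑ i : Fin d, v i.succ ^ 2 = 0 := by rw [hc] at hv; linarith
    have h1 := (Finset.sum_eq_zero_iff_of_nonneg fun i _ => sq_nonneg (v (Fin.succ i))).1 h0
    apply Subtype.ext
    ext i
    refine Fin.cases ?_ (fun i => ?_) i
    · simp [StdSphere.base, hc]
    · have := pow_eq_zero_iff (two_ne_zero) |>.1 (h1 i (Finset.mem_univ i))
      simp [StdSphere.base, this]
  · have hc1 : v 0 < 1 := by
      refine lt_of_le_of_ne ?_ hc
      have : 0 ≤ ∑ i : Fin d, v i.succ ^ 2 := Finset.sum_nonneg fun _ _ => sq_nonneg _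
      nlinarith
    -- `y` is the stereographic projection of `v`. The scale `b` solves ‖b y‖ = 1 - b, so the point
    -- with centred coordinates `b • y` has depth exactly `b`.
    set y : Fin d → ℝ := fun i => v i.succ / (1 - v 0) with hy
    set b : ℝ := 1 / (1 + ‖y‖) with hb
    have hy0 : 0 ≤ ‖y‖ := norm_nonneg y
    have hbpos : 0 < b := by positivity
    have hby : ‖b • y‖ = 1 - b := by
      rw [norm_smul, Real.norm_of_nonneg hbpos.le, hb]
      field_simp
      ring
    have hu : ∀ i, |b * y i| ≤ 1 := fun i => by
      have := norm_le_pi_norm (b • y) i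
      rw [hby] at this
      exact this.trans (by linarith)
    let x : Fin d → I := fun i => ⟨(b * y i + 1) / 2, by
      have := abs_le.1 (hu i); constructor <;> linarith⟩
    have hxu : cubeCentred x = b • y := by
      ext i
      simp only [cubeCentred, x, Pi.smul_apply, smul_eq_mul]
      ring
    have hxb : cubeDepth x = b := by rw [cubeDepth, hxu, hby]; ring
    have hs : (1 - v 0) ≠ 0 := by linarith
    have hxs : cubeSq x = b ^ 2 * ((1 + v 0) / (1 - v 0)) := by
      have h2 : ∑ i : Fin d, v i.succ ^ 2 = (1 - v 0) * (1 + v 0) := by linarith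
      simp only [cubeSq, hxu, Pi.smul_apply, smul_eq_mul, mul_pow, hy, div_pow]
      rw [← Finset.mul_sum, ← Finset.sum_div, h2]
      field_simp
    have hD : cubeSq x + cubeDepth x ^ 2 = b ^ 2 * (2 / (1 - v 0)) := by
      rw [hxs, hxb]; field_simp; ring
    refine ⟨x, Subtype.ext ?_⟩
    ext i
    change cubeToSphereVec x i = v i
    refine Fin.cases ?_ (fun i => ?_) i
    · rw [cubeToSphereVec_zero, hD, hxs, hxb]
      field_simp
      ring
    · rw [cubeToSphereVec_succ, hD, hxb, hxu]
      simp only [Pi.smul_apply, smul_eq_mul, hy]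
      field_simp

/-- With b the depth and u the centred vector, the image determines k·(b, u), where k = 2b/(|u|² +
b²). Off the boundary this fixes the ray through (b, u), and ‖u‖ = 1 - b in the sup norm singles out
one point on it. -/
theorem cubeToSphere_eq_or (x x' : Fin d → I)
    (h : cubeToSphere d x = cubeToSphere d x') :
    x = x' ∨ (x ∈ Cube.boundary (Fin d) ∧ x' ∈ Cube.boundary (Fin d)) := by
  have hv : cubeToSphereVec x = cubeToSphereVec x' := congrArg Subtype.val h
  have hD := cubeSq_add_pos x
  have hD' := cubeSq_add_pos x'
  set k := 2 * cubeDepth x / (cubeSq x + cubeDepth x ^ 2) with hk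
  set k' := 2 * cubeDepth x' / (cubeSq x' + cubeDepth x' ^ 2) with hk'
  have h0 : k * cubeDepth x = k' * cubeDepth x' := by
    have h1 : cubeToSphereVec x 0 = cubeToSphereVec x' 0 := by rw [hv]
    rw [cubeToSphereVec_zero, cubeToSphereVec_zero] at h1
    have e1 : k * cubeDepth x
        = 1 - (cubeSq x - cubeDepth x ^ 2) / (cubeSq x + cubeDepth x ^ 2) := by
      rw [hk]; field_simp; ring
    have e2 : k' * cubeDepth x'
        = 1 - (cubeSq x' - cubeDepth x' ^ 2) / (cubeSq x' + cubeDepth x' ^ 2) := by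
      rw [hk']; field_simp; ring
    rw [e1, e2, h1]
  have hi : ∀ i, k * cubeCentred x i = k' * cubeCentred x' i := fun i => by
    have h1 : cubeToSphereVec x i.succ = cubeToSphereVec x' i.succ := by rw [hv]
    rw [cubeToSphereVec_succ, cubeToSphereVec_succ] at h1
    rw [hk, hk', div_mul_eq_mul_div, div_mul_eq_mul_div, h1]
  have hk0 : k = 0 ↔ cubeDepth x = 0 := by rw [hk]; simp [hD.ne']
  have hk0' : k' = 0 ↔ cubeDepth x' = 0 := by rw [hk']; simp [hD'.ne']
  rw [← cubeDepth_eq_zero_iff, ← cubeDepth_eq_zero_iff]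
  by_cases hb : cubeDepth x = 0
  · refine Or.inr ⟨hb, ?_⟩
    rw [hb, mul_zero, eq_comm, mul_eq_zero, hk0', or_self] at h0
    exact h0
  · left
    have hkn : k ≠ 0 := fun h => hb (hk0.1 h)
    have hu : cubeDepth x' • cubeCentred x = cubeDepth x • cubeCentred x' := by
      ext i
      simp only [Pi.smul_apply, smul_eq_mul]
      apply mul_left_cancel₀ hkn
      calc k * (cubeDepth x' * cubeCentred x i) = cubeDepth x' * (k * cubeCentred x i) := by ring
        _ = (k' * cubeDepth x') * cubeCentred x' i := by rw [hi]; ring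
        _ = k * (cubeDepth x * cubeCentred x' i) := by rw [← h0]; ring
    have hn := congrArg norm hu
    rw [norm_smul, norm_smul, Real.norm_of_nonneg (cubeDepth_nonneg x),
      Real.norm_of_nonneg (cubeDepth_nonneg x')] at hn
    have e1 : ‖cubeCentred x‖ = 1 - cubeDepth x := by simp [cubeDepth]
    have e2 : ‖cubeCentred x'‖ = 1 - cubeDepth x' := by simp [cubeDepth]
    rw [e1, e2] at hn
    have hbb : cubeDepth x' = cubeDepth x := by linarith
    rw [hbb] at hu
    have hc := smul_right_injective _ hb hu
    funext i
    have := congrFun hc i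
    simp only [cubeCentred] at this
    exact Subtype.ext (by linarith)

theorem isCollapse_cubeToSphere (hd : 1 ≤ d) :
    IsCollapse (cubeToSphere d) (Cube.boundary (Fin d)) (StdSphere.base d) where
  isQuotientMap := (cubeToSphere d).continuous.isClosedMap.isQuotientMap
    (cubeToSphere d).continuous (cubeToSphere_surjective hd)
  map_eq _ hx := cubeToSphere_of_mem_boundary hx
  eq_or := cubeToSphere_eq_or
  nonempty := ⟨fun _ => 0, ⟨0, hd⟩, Or.inl rfl⟩

end CubeToSphere

/-! ### Free loops in function spaces and `T`-spaces -/

section TSpace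

variable {X Y T : Type*} [TopologicalSpace X] [TopologicalSpace Y] [TopologicalSpace T]

theorem homotopic_of_pathConnected {K : Type*} [TopologicalSpace K] [PathConnectedSpace K]
    [LocallyCompactSpace X] {f : C(X, Y)} (γ : C(K, C(X, Y))) (k₀ k : K)
    (h : (γ k₀).Homotopic f) : (γ k).Homotopic f := by
  refine ContinuousMap.Homotopic.trans ?_ h
  rw [homotopic_iff_mem_pathComponent]
  exact (PathConnectedSpace.joined k₀ k).map γ.continuous

instance : PathConnectedSpace Circle := by
  have h : IsPathConnected (Set.range Circle.exp) := isPathConnected_range Circle.exp.continuous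
  rw [Circle.exp_surjective.range_eq] at h
  exact pathConnectedSpace_iff_univ.2 h

variable [LocallyCompactSpace X]

/-- A free loop in a function space component, at a point of the source, is a free loop. -/
noncomputable def loopAdjoint (f : C(X, Y)) :
    C(C(Circle, MapComponent f) × X, C(Circle, Y)) :=
  ContinuousMap.curry ⟨fun p : (C(Circle, MapComponent f) × X) × Circle =>
    (p.1.1 p.2).1 p.1.2, by fun_prop⟩

/-- A family of free loops in a function space, given by its adjoint. -/
noncomputable def loopFamilyAux (Φ : C(T × X, C(Circle, Y))) : C(T × Circle, C(X, Y)) :=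
  ContinuousMap.curry ⟨fun p : (T × Circle) × X => Φ (p.1.1, p.2) p.1.2, by fun_prop⟩

/-- The circle is path connected, so membership in the component need only be checked at `1`. -/
theorem loopFamilyAux_homotopic (f : C(X, Y)) (Φ : C(T × X, C(Circle, Y)))
    (h : ∀ t, ∃ g : MapComponent f, ∀ x, Φ (t, x) 1 = g.1 x) (p : T × Circle) :
    (loopFamilyAux Φ p).Homotopic f := by
  refine homotopic_of_pathConnected ((loopFamilyAux Φ).curry p.1) 1 p.2 ?_
  obtain ⟨g, hg⟩ := h p.1
  have : (loopFamilyAux Φ).curry p.1 1 = g.1 := by ext x; exact hg x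
  rw [this]
  exact g.2

/-- A family of free loops in a function space component, given by its adjoint. -/
noncomputable def loopFamily (f : C(X, Y)) (Φ : C(T × X, C(Circle, Y)))
    (h : ∀ t, ∃ g : MapComponent f, ∀ x, Φ (t, x) 1 = g.1 x) :
    C(T, C(Circle, MapComponent f)) :=
  ContinuousMap.curry ⟨fun p => ⟨loopFamilyAux Φ p, loopFamilyAux_homotopic f Φ h p⟩,
    (loopFamilyAux Φ).continuous.subtype_mk _⟩

/-- The based loop space, as the fibre of the free loop fibration. -/
abbrev LoopFibre (Z : Type*) [TopologicalSpace Z] (z₀ : Z) : Type _ :=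
  {e : C(Circle, Z) // freeLoopEval Z e = z₀}

theorem isTSpace_nullComponent {y₀ : Y} (hY : IsTSpace Y y₀) :
    IsTSpace (NullComponent X y₀) (MapComponent.base (nullMap X y₀)) := by
  obtain ⟨f, g, hf, hg, ⟨H, hH⟩, H', hH'⟩ := hY
  let n := nullMap X y₀
  have hFib : Continuous fun p : (MapComponent n × LoopFibre (MapComponent n) (MapComponent.base n)) × X => (p.1.2.1 : C(Circle, MapComponent n)) :=
    continuous_subtype_val.comp (continuous_snd.comp continuous_fst)
  have hadjFib : ∀ p : (MapComponent n × LoopFibre (MapComponent n) (MapComponent.base n)) × X,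
      freeLoopEval Y (loopAdjoint n (p.1.2.1, p.2)) = y₀ := fun p => by
    have h1 : p.1.2.1 1 = MapComponent.base n := p.1.2.2
    change (p.1.2.1 1).1 p.2 = y₀
    rw [h1]; rfl
  let adjFib : C((MapComponent n × LoopFibre (MapComponent n) (MapComponent.base n)) × X,
      LoopFibre Y y₀) :=
    ⟨fun p => ⟨loopAdjoint n (p.1.2.1, p.2), hadjFib p⟩,
      ((loopAdjoint n).continuous.comp (hFib.prodMk continuous_snd)).subtype_mk hadjFib⟩
  -- For families of loops based at `y₀`, the value at `1` is the null map. This gives both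
  -- membership in the component and membership in the fibre over its base point.
  have toFib {T : Type _} [TopologicalSpace T]
      (Φ : C(T × X, Y × LoopFibre Y y₀)) :
      ∃ R : C(T, LoopFibre (MapComponent n) (MapComponent.base n)), ∀ t z x, ((R t).1 z).1 x = (Φ (t, x)).2.1 z := by
    have h1 : ∀ p, (Φ p).2.1 1 = y₀ := fun p => (Φ p).2.2
    let R := loopFamily n ⟨fun p => (Φ p).2.1, by fun_prop⟩
      (fun t => ⟨MapComponent.base n, fun x => h1 _⟩)
    have hR : ∀ t, freeLoopEval (MapComponent n) (R t) = MapComponent.base n := fun t => by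
      apply Subtype.ext
      ext x
      exact h1 _
    exact ⟨⟨fun t => ⟨R t, hR t⟩, R.continuous.subtype_mk hR⟩, fun t z x => rfl⟩
  obtain ⟨F, hF⟩ := toFib (f.comp (loopAdjoint n))
  let pt : C((MapComponent n × LoopFibre (MapComponent n) (MapComponent.base n)) × X, Y × LoopFibre Y y₀) :=
    ⟨fun p => (p.1.1.1 p.2, adjFib p), by fun_prop⟩
  have hf1 : ∀ e, (f e).1 = e 1 := hf
  have hg1 : ∀ e, g e 1 = e.1 := hg
  have hH1 : ∀ t e, H (t, e) 1 = e 1 := hH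
  let f' : C(C(Circle, MapComponent n), MapComponent n × LoopFibre (MapComponent n) (MapComponent.base n)) := (freeLoopEval (MapComponent n)).prodMk F
  let g' : C(MapComponent n × LoopFibre (MapComponent n) (MapComponent.base n), C(Circle, MapComponent n)) := loopFamily n (g.comp pt) (fun t => ⟨t.1, fun x => hg1 _⟩)
  let K : C(I × C(Circle, MapComponent n), C(Circle, MapComponent n)) := loopFamily n
    ⟨fun p => H (p.1.1, loopAdjoint n (p.1.2, p.2)), by fun_prop⟩
    (fun t => ⟨t.2 1, fun x => hH1 _ _⟩)
  obtain ⟨R, hR⟩ := toFib (T := I × (MapComponent n × LoopFibre (MapComponent n) (MapComponent.base n)))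
    ⟨fun p => H' (p.1.1, pt (p.1.2, p.2)), by fun_prop⟩
  have hadj : ∀ e x, loopAdjoint n (g' e, x) = g (pt (e, x)) := fun e x => rfl
  refine ⟨f', g', fun e => rfl, fun e => ?_, ⟨⟨K, fun e => ?_, fun e => ?_⟩, fun t e => ?_⟩,
    ⟨⟨⟨fun p => (p.2.1, R p), by fun_prop⟩, fun e => ?_, fun e => ?_⟩, fun t e => rfl⟩⟩
  · apply Subtype.ext
    ext x
    exact hg1 _
  · ext z x
    change H (0, loopAdjoint n (e, x)) z = g ((e 1).1 x, _) z
    rw [H.apply_zero]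
    change g (f (loopAdjoint n (e, x))) z = _
    -- The first coordinates agree because `f` lies over `Y`, the second by the construction of `F`.
    have h2 : f (loopAdjoint n (e, x)) = pt (f' e, x) := by
      refine Prod.ext (hf1 _) (Subtype.ext ?_)
      ext w
      exact (hF e w x).symm
    rw [h2]
    rfl
  · ext z x
    change H (1, loopAdjoint n (e, x)) z = _
    rw [H.apply_one]
    rfl
  · apply Subtype.ext
    ext x
    exact hH1 _ _
  · refine Prod.ext ?_ (Subtype.ext ?_)
    · apply Subtype.ext
      ext x
      exact (hg1 (pt (e, x))).symm
    · ext z x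
      refine (hR (0, e) z x).trans (Eq.trans ?_ (hF (g' e) z x).symm)
      change (H' (0, pt (e, x))).2.1 z = (f (loopAdjoint n (g' e, x))).2.1 z
      rw [H'.apply_zero, hadj]
      rfl
  · refine Prod.ext rfl (Subtype.ext ?_)
    ext z x
    refine (hR (1, e) z x).trans ?_
    change (H' (1, pt (e, x))).2.1 z = _
    rw [H'.apply_one]
    rfl

end TSpace
universe u v

/-! ### Lifting families over spaces whose suspension splits -/

section Splitting

variable {A B : Type*} [TopologicalSpace A] [TopologicalSpace B] {φ : C(A, B)} {a : A}

/-- A family of `N`-loops over S^d is a map on a cube indexed by `Fin d ⊕ N`, constant on the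
boundary. As `1 ≤ d`, this index type is nonempty even when `N` is empty. -/
theorem liftsRel_stdSphere (hφ : ∀ (N : Type) [Finite N] [Nonempty N],
      LiftsRel φ a (Cube.boundary N)) (N : Type) [Finite N] {d : ℕ} (hd : 1 ≤ d) :
    LiftsRel (genLoopMapC N φ a) GenLoop.const {StdSphere.base d} := by
  have : Nonempty (Fin d) := ⟨⟨0, hd⟩⟩
  rw [(isCollapse_cubeToSphere hd).liftsRel_iff, liftsRel_genLoopMapC_iff]
  refine (hφ (Fin d ⊕ N)).of_homeomorph Homeomorph.sumArrowHomeomorphProdArrow.symm ?_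
  rintro ⟨s, t⟩
  exact Cube.boundary_sum_iff

theorem liftsRel_of_splitsAsWedge (hφ : ∀ (N : Type) [Finite N] [Nonempty N],
      LiftsRel φ a (Cube.boundary N)) (N : Type) [Finite N] {Z : Type*} [TopologicalSpace Z]
    {z : Z} (hZ : SplitsAsWedgeOfSpheres Z z) :
    LiftsRel (genLoopMapC N φ a) GenLoop.const {z} := by
  obtain ⟨ι, d, hd, f, g, hf, hg, hgf, -⟩ := hZ
  have hW : LiftsRel (genLoopMapC N φ a) GenLoop.const {WedgeOfSpheres.base d} :=
    (isCollapse_mk (z := Sum.inl PUnit.unit) (S := {p : PUnit ⊕ (Σ i : ι, StdSphere (d i)) |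
      p = Sum.inl PUnit.unit ∨ ∃ i, p = Sum.inr ⟨i, StdSphere.base (d i)⟩})
      (Or.inl rfl)).liftsRel_iff.2 (liftsRel_punit_sum_sigma _ fun i => liftsRel_stdSphere hφ N (hd i))
  exact hW.of_dominated f g (by rintro x rfl; exact hf) (by rintro x rfl; exact hg) hgf

/-- Splitting off the first coordinate of a cube. -/
def prodCubeHomeomorph (X : Type*) [TopologicalSpace X] (m : ℕ) :
    X × (Fin (m + 1) → I) ≃ₜ (X × I) × (Fin m → I) where
  toFun p := ((p.1, p.2 0), fun i => p.2 i.succ)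
  invFun p := (p.1.1, Fin.cons p.1.2 p.2)
  left_inv p := Prod.ext rfl (Fin.cons_self_tail p.2)
  right_inv p := rfl
  continuous_toFun := by fun_prop
  continuous_invFun := by
    refine (continuous_fst.comp continuous_fst).prodMk (continuous_pi fun i => ?_)
    refine Fin.cases ?_ (fun i => ?_) i
    · exact continuous_snd.comp continuous_fst
    · exact (continuous_apply i).comp continuous_snd

/-- If `φ` is onto on homotopy groups and `ΣX` splits as a wedge of spheres, then families over
`X` of loops, trivial over the base point, lift through `φ`. -/
theorem liftsRel_prod_cube (hφ : ∀ (N : Type) [Finite N] [Nonempty N],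
      LiftsRel φ a (Cube.boundary N)) {X : Type*} [TopologicalSpace X] {x₀ : X}
    (hX : SplitsAsWedgeOfSpheres (ReducedSuspension X x₀) (ReducedSuspension.base x₀)) (m : ℕ) :
    LiftsRel φ a {p : X × (Fin (m + 1) → I) | p.1 = x₀ ∨ p.2 ∈ Cube.boundary (Fin (m + 1))} := by
  -- The first cube coordinate serves as suspension coordinate; the other `m` give a family of loops
  -- over ΣX.
  have h1 := (isCollapse_mk (S := {p : X × I | p.1 = x₀ ∨ p.2 = 0 ∨ p.2 = 1})
    (z := (x₀, 0)) (Or.inl rfl)).liftsRel_iff.1 (liftsRel_of_splitsAsWedge hφ (Fin m) hX)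
  refine (liftsRel_genLoopMapC_iff.1 h1).of_homeomorph (prodCubeHomeomorph X m) ?_
  rintro ⟨x, s⟩
  change ((x = x₀ ∨ s 0 = 0 ∨ s 0 = 1) ∨ ∃ i : Fin m, s i.succ = 0 ∨ s i.succ = 1) ↔
    (x = x₀ ∨ ∃ i, s i = 0 ∨ s i = 1)
  rw [Fin.exists_fin_succ, or_assoc]

/-- Surjectivity on homotopy groups, read on representatives. General finite index types are allowed
because cubes indexed by sums occur above. -/
theorem IsGSpace.liftsRel {Z : Type*} [TopologicalSpace Z] {z₀ : Z} (h : IsGSpace Z z₀)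
    (N : Type) [Finite N] [Nonempty N] :
    LiftsRel (evalMap z₀) (MapComponent.base (ContinuousMap.id Z)) (Cube.boundary N) := by
  have hfin : ∀ m : ℕ, LiftsRel (evalMap z₀) (MapComponent.base (ContinuousMap.id Z))
      (Cube.boundary (Fin (m + 1))) := fun m g hg => by
    let p : GenLoop (Fin (m + 1)) Z z₀ := ⟨g, hg⟩
    have hp : (Quotient.mk _ p : HomotopyGroup.Pi (m + 1) Z z₀) ∈ gottliebGroup m Z z₀ := by
      rw [h m]; trivial
    obtain ⟨x, hx⟩ := hp
    obtain ⟨G, rfl⟩ := Quotient.exists_rep x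
    exact ⟨G.1, G.2, Quotient.exact hx⟩
  obtain ⟨n, ⟨e⟩⟩ := Finite.exists_equiv_fin N
  obtain ⟨m, rfl⟩ : ∃ m, n = m + 1 := by
    refine Nat.exists_eq_succ_of_ne_zero ?_
    rintro rfl
    exact (e (Classical.arbitrary N)).elim0
  let E : (N → I) ≃ₜ (Fin (m + 1) → I) :=
    { toFun := fun x j => x (e.symm j)
      invFun := fun x j => x (e j)
      left_inv := fun x => by ext j; simp
      right_inv := fun x => by ext j; simp
      continuous_toFun := by fun_prop
      continuous_invFun := by fun_prop }
  exact (hfin m).of_homeomorph E fun x => e.symm.exists_congr fun j => Iff.rfl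

end Splitting

/-- Homotopy extension for a well-pointed space, with target in any universe. -/
theorem WellPointed.exists_extension {X : Type u} [TopologicalSpace X] {x₀ : X}
    (hX : WellPointed X x₀) {Z : Type v} [TopologicalSpace Z] (f : C(X, Z)) (h : C(I, Z))
    (h0 : h 0 = f x₀) :
    ∃ H : C(I × X, Z), (∀ x, H (0, x) = f x) ∧ ∀ t, H (t, x₀) = h t := by
  -- The space obtained by gluing `0` in `I` to `x₀` is the universal target and lives in the
  -- universe of `X`; extend there, then map to `Z`.
  let r : X ⊕ I → X ⊕ I → Prop := fun p q => p = Sum.inr 0 ∧ q = Sum.inl x₀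
  obtain ⟨H, hH0, hH⟩ := hX (Quot r) ⟨fun x => Quot.mk r (Sum.inl x), by fun_prop⟩
    ⟨fun t => Quot.mk r (Sum.inr t), by fun_prop⟩ (Quot.sound ⟨rfl, rfl⟩)
  let k : C(Quot r, Z) := ⟨Quot.lift (Sum.elim f h) (by rintro _ _ ⟨rfl, rfl⟩; exact h0),
    continuous_quot_lift _ (f.continuous.sumElim h.continuous)⟩
  refine ⟨k.comp H, fun x => ?_, fun t => ?_⟩
  · exact congrArg k (hH0 x)
  · exact congrArg k (hH t)

/-! ### Gottlieb groups of the null component -/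

section Gottlieb

variable {X Y : Type*} [TopologicalSpace X] [TopologicalSpace Y]

instance : PathConnectedSpace I :=
  isPathConnected_iff_pathConnectedSpace.1 ((convex_Icc (0 : ℝ) 1).isPathConnected ⟨0, by simp⟩)

/-- Joint continuity of `F` replaces local compactness of the source, so this applies to self-maps
of the function space. -/
theorem homotopic_curry {K : Type*} [TopologicalSpace K] [PathConnectedSpace K]
    (F : C(K × X, Y)) (k k' : K) : (F.curry k).Homotopic (F.curry k') := by
  obtain ⟨γ⟩ := PathConnectedSpace.joined k k'
  exact ⟨⟨F.comp (γ.toContinuousMap.prodMap (ContinuousMap.id X)),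
    fun x => by simp, fun x => by simp⟩⟩

variable [LocallyCompactSpace X] [LocallyCompactSpace Y] {y₀ : Y} {m : ℕ}

/-- The family over `X` of loops in `Y` given by a loop of maps `X → Y`. -/
def cubeAdjoint {N : Type*} {f : C(X, Y)} (α : C(N → I, MapComponent f)) : C(X × (N → I), Y) :=
  ⟨fun p => (α p.2).1 p.1, by fun_prop⟩

/-- A family over `X` of loops in `aut₁ Y` based at the identity acts on `map(X, Y; 0)`, so the
family of loops obtained by evaluation at `y₀` represents an element of the Gottlieb group. -/
theorem mk_mem_gottliebGroup
    (α : GenLoop (Fin (m + 1)) (NullComponent X y₀) (MapComponent.base (nullMap X y₀)))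
    (Θ : C(X × (Fin (m + 1) → I), AutOne Y))
    (hΘ : ∀ p : X × (Fin (m + 1) → I), p.2 ∈ Cube.boundary (Fin (m + 1)) →
      Θ p = MapComponent.base (ContinuousMap.id Y))
    (hα : ((evalMap y₀).comp Θ).HomotopicRel (cubeAdjoint α.1)
      {p : X × (Fin (m + 1) → I) | p.2 ∈ Cube.boundary (Fin (m + 1))}) :
    (Quotient.mk _ α : HomotopyGroup.Pi (m + 1) (NullComponent X y₀) _) ∈
      gottliebGroup m (NullComponent X y₀) (MapComponent.base (nullMap X y₀)) := by
  let M := NullComponent X y₀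
  let Q := Fin (m + 1) → I
  have h0 : (0 : Q) ∈ Cube.boundary (Fin (m + 1)) := ⟨0, Or.inl rfl⟩
  -- The pointwise action of Θ. It is the identity for `s` on the boundary, and path connectedness
  -- of the cube keeps it in the component for all `s`.
  let Ψ₁ : C(M × Q, C(X, Y)) := ContinuousMap.curry
    ⟨fun p : (NullComponent X y₀ × (Fin (m + 1) → I)) × X =>
      (Θ (p.2, p.1.2)).1 (p.1.1.1 p.2), by fun_prop⟩
  have hΨ₁ : ∀ g s, s ∈ Cube.boundary (Fin (m + 1)) → Ψ₁ (g, s) = g.1 := fun g s hs => by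
    ext x
    change (Θ (x, s)).1 (g.1 x) = g.1 x
    rw [hΘ (x, s) hs]; rfl
  have hM : ∀ p, (Ψ₁ p).Homotopic (nullMap X y₀) := fun p =>
    homotopic_of_pathConnected (Ψ₁.curry p.1) 0 p.2 (by
      change (Ψ₁ (p.1, 0)).Homotopic _
      rw [hΨ₁ _ _ h0]; exact p.1.2)
  let Ψ₂ : C(Q × M, M) := ⟨fun p => ⟨Ψ₁ (p.2, p.1), hM _⟩, by fun_prop⟩
  have hΨ₂ : ∀ s, s ∈ Cube.boundary (Fin (m + 1)) → Ψ₂.curry s = ContinuousMap.id M :=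
    fun s hs => by ext1 g; exact Subtype.ext (hΨ₁ g s hs)
  have hid : ∀ s, (Ψ₂.curry s).Homotopic (ContinuousMap.id M) := fun s => by
    have := homotopic_curry Ψ₂ s 0
    rwa [hΨ₂ 0 h0] at this
  let Ψ : GenLoop (Fin (m + 1)) (AutOne M) (MapComponent.base (ContinuousMap.id M)) :=
    ⟨⟨fun s => ⟨Ψ₂.curry s, hid s⟩, Ψ₂.curry.continuous.subtype_mk hid⟩,
      fun s hs => Subtype.ext (hΨ₂ s hs)⟩
  refine ⟨Quotient.mk _ Ψ, Quotient.sound ?_⟩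
  -- Evaluating Ψ at the null map gives x ↦ Θ(x, s)(y₀), which `hα` deforms to α.
  obtain ⟨H, hH0, hH1, hHS⟩ := HomotopicRel.exists_map hα
  let K : C(I × Q, C(X, Y)) := ContinuousMap.curry
    ⟨fun p : (I × (Fin (m + 1) → I)) × X => H (p.1.1, (p.2, p.1.2)), by fun_prop⟩
  have hK1 : ∀ s, K (1, s) = (α s).1 := fun s => by ext x; exact hH1 (x, s)
  have hK : ∀ p, (K p).Homotopic (nullMap X y₀) := fun p =>
    homotopic_of_pathConnected ((K.comp ContinuousMap.prodSwap).curry p.2) 1 p.1 (by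
      change (K (1, p.2)).Homotopic _
      rw [hK1]; exact (α p.2).2)
  refine homotopicRel_of_map ⟨fun p => ⟨K p, hK p⟩, by fun_prop⟩ ?_ ?_ ?_
  · intro s
    apply Subtype.ext
    ext x
    exact hH0 (x, s)
  · intro s
    exact Subtype.ext (hK1 s)
  · intro t s hs
    apply Subtype.ext
    ext x
    exact hHS t (x, s) hs

/-- Evaluation at a point of `X` on `map(X, Y; 0)`. -/
def evalAt (y₀ : Y) (x₀ : X) : C(NullComponent X y₀, Y) :=
  ⟨fun g => g.1 x₀, by fun_prop⟩

theorem mk_mem_gottliebGroup_of_map_eq_one {x₀ : X} (hX : WellPointed X x₀)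
    (hS : SplitsAsWedgeOfSpheres (ReducedSuspension X x₀) (ReducedSuspension.base x₀))
    (hY : IsGSpace Y y₀)
    (δ : GenLoop (Fin (m + 1)) (NullComponent X y₀) (MapComponent.base (nullMap X y₀)))
    (hδ : GenLoop.Homotopic (genLoopMap (evalAt y₀ x₀) _ δ) GenLoop.const) :
    (Quotient.mk _ δ : HomotopyGroup.Pi (m + 1) (NullComponent X y₀) _) ∈
      gottliebGroup m (NullComponent X y₀) (MapComponent.base (nullMap X y₀)) := by
  obtain ⟨h, hh0, hh1, hhS⟩ := HomotopicRel.exists_map hδ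
  have hδb : ∀ x, ∀ s ∈ Cube.boundary (Fin (m + 1)), cubeAdjoint δ.1 (x, s) = y₀ :=
    fun x s hs => by
      have h1 : δ s = MapComponent.base (nullMap X y₀) := δ.2 s hs
      change (δ s).1 x = y₀
      rw [h1]; rfl
  -- Homotopy extension with the loop space of `Y` as target: the null-homotopy over `x₀` extends
  -- over `X` while X × ∂I^(m+1) stays at `y₀`.
  obtain ⟨H, hH0, hH⟩ := hX.exists_extension (genLoopCurry (cubeAdjoint δ.1) y₀ hδb)
    (genLoopCurry h y₀ fun t s hs => (hhS t s hs).trans (hδb x₀ s hs))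
    (by ext s; exact hh0 s)
  let U : C(I × (X × (Fin (m + 1) → I)), Y) :=
    (genLoopUncurry H).comp (Homeomorph.prodAssoc I X (Fin (m + 1) → I)).symm
  have hU0 : ∀ p, U (0, p) = cubeAdjoint δ.1 p := fun p =>
    DFunLike.congr_fun (hH0 p.1) p.2
  have hUb : ∀ t, ∀ p : X × (Fin (m + 1) → I), p.2 ∈ Cube.boundary (Fin (m + 1)) →
      U (t, p) = y₀ := fun t p hp => (H (t, p.1)).2 p.2 hp
  let β : C(X × (Fin (m + 1) → I), Y) := ⟨fun p => U (1, p), by fun_prop⟩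
  obtain ⟨Θ, hΘ, hΘβ⟩ := liftsRel_prod_cube hY.liftsRel hS m β (by
    rintro ⟨x, s⟩ (rfl | hs)
    · exact (DFunLike.congr_fun (hH 1) s).trans (hh1 s)
    · exact hUb 1 (x, s) hs)
  refine mk_mem_gottliebGroup δ Θ (fun p hp => hΘ p (Or.inr hp)) ?_
  have h1 := HomotopicRel.precomp hΘβ (ContinuousMap.id _)
    (S' := {p : X × (Fin (m + 1) → I) | p.2 ∈ Cube.boundary (Fin (m + 1))}) fun p hp => Or.inr hp
  refine ContinuousMap.HomotopicRel.trans h1 (ContinuousMap.HomotopicRel.symm ?_)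
  exact homotopicRel_of_map U hU0 (fun p => rfl) fun t p hp =>
    (hUb t p hp).trans (hδb p.1 p.2 hp).symm

theorem isGSpace_nullComponent {x₀ : X} (hX : WellPointed X x₀)
    (hS : SplitsAsWedgeOfSpheres (ReducedSuspension X x₀) (ReducedSuspension.base x₀))
    (hY : IsGSpace Y y₀) :
    IsGSpace (NullComponent X y₀) (MapComponent.base (nullMap X y₀)) := by
  intro m
  rw [eq_top_iff]
  intro a _
  let e := homotopyGroupMap (Fin (m + 1)) (evalAt y₀ x₀) (MapComponent.base (nullMap X y₀))
  obtain ⟨b, hb, hab⟩ : ∃ b ∈ gottliebGroup m (NullComponent X y₀)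
      (MapComponent.base (nullMap X y₀)), e b = e a := by
    obtain ⟨α, rfl⟩ := Quotient.exists_rep a
    obtain ⟨G, hG, hH⟩ := hY.liftsRel (Fin (m + 1)) (genLoopMap (evalAt y₀ x₀) _ α).1
      (genLoopMap (evalAt y₀ x₀) _ α).2
    -- The loop of constant maps with value `(G s).1 y₀`; at `x₀` it evaluates to a loop homotopic
    -- to that of α.
    let c : C(Fin (m + 1) → I, C(X, Y)) := ContinuousMap.curry
      ⟨fun p : (Fin (m + 1) → I) × X => (G p.1).1 y₀, by fun_prop⟩
    have hc : ∀ s ∈ Cube.boundary (Fin (m + 1)), c s = nullMap X y₀ := fun s hs => by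
      ext x
      change (G s).1 y₀ = y₀
      rw [hG s hs]; rfl
    let β : GenLoop (Fin (m + 1)) (NullComponent X y₀) (MapComponent.base (nullMap X y₀)) :=
      ⟨⟨fun s => ⟨c s, homotopic_of_pathConnected c 0 s (by
        rw [hc 0 ⟨0, Or.inl rfl⟩])⟩, by fun_prop⟩, fun s hs => Subtype.ext (hc s hs)⟩
    refine ⟨Quotient.mk _ β, ?_, Quotient.sound hH⟩
    exact mk_mem_gottliebGroup β ⟨fun p => G p.2, by fun_prop⟩ (fun p hp => hG _ hp)
      (ContinuousMap.HomotopicRel.refl _)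
  -- Dividing by `b` moves the class into the kernel of `e`, where the splitting of ΣX applies.
  have hmem : a * b⁻¹ ∈ gottliebGroup m (NullComponent X y₀)
      (MapComponent.base (nullMap X y₀)) := by
    have h1 : e (a * b⁻¹) = 1 := by rw [map_mul, map_inv, hab, mul_inv_cancel]
    obtain ⟨δ, hδ⟩ := Quotient.exists_rep (a * b⁻¹)
    rw [← hδ] at h1 ⊢
    exact mk_mem_gottliebGroup_of_map_eq_one hX hS hY δ (Quotient.exact h1)
  have := mul_mem hmem hb
  rwa [inv_mul_cancel_right] at this

end Gottlieb

end FunctionSpace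

theorem mainTheorem7 {X : Type*} {Y : Type*} [TopologicalSpace X] [TopologicalSpace Y]
    [T2Space X] [LocallyCompactSpace X] [ConnectedSpace X]
    [T2Space Y] [LocallyCompactSpace Y] [ConnectedSpace Y]
    (x₀ : X) (y₀ : Y)
    (hX : FunctionSpace.WellPointed X x₀) (hY : FunctionSpace.WellPointed Y y₀) :
    (FunctionSpace.IsTSpace Y y₀ →
      FunctionSpace.IsTSpace (FunctionSpace.NullComponent X y₀)
        (FunctionSpace.MapComponent.base (FunctionSpace.nullMap X y₀))) ∧
    (FunctionSpace.SplitsAsWedgeOfSpheres (FunctionSpace.ReducedSuspension X x₀)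
        (FunctionSpace.ReducedSuspension.base x₀) →
      FunctionSpace.IsGSpace Y y₀ →
      FunctionSpace.IsGSpace (FunctionSpace.NullComponent X y₀)
        (FunctionSpace.MapComponent.base (FunctionSpace.nullMap X y₀))) :=
  ⟨fun h => FunctionSpace.isTSpace_nullComponent h,
    fun hS h => FunctionSpace.isGSpace_nullComponent hX hS h⟩
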